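/- Let $G$ be a connected complex linear algebraic group, $V$ a finite-dimensional complex vector space and $\rho:G\to\mathrm{GL}(V)$ a rational representation with a (Zariski) open orbit $\Omega\subseteq V$, i.e. $(G,\rho,V)$ is a prehomogeneous vector space. For $v\in V$ let $G_v=\{g\in G:\rho(g)v=v\}$, and for a polynomial $p\in\mathbb{C}[V]$ let $V(p)$ be its zero set. Let $f_1,\dots,f_r\in\mathbb{C}[V]$ be the basic relative invariants, that is, irreducible polynomials such that $V(f_1),\dots,V(f_r)$ are, without repetition, exactly those irreducible components of $V\setminus\Omega$ that are hypersurfaces. An additive function of $G$ is a homomorphism of algebraic groups $\Phi:G\to(\mathbb{C},+)$. A rational function $k$ on $V$ is an additive relative invariant with associated additive function $\Phi$ if $k$ is defined on $\Omega$ and $k(\rho(g)v)-k(v)=\Phi(g)$ for all $v\in\Omega$ and $g\in G$. Let $\mathscr{A}_1(G)$ be the complex vector space of those additive functions $\Phi$ of $G$ that are associated with some additive relative invariant. Let $\Phi_1,\dots,\Phi_s$ be a basis of $\mathscr{A}_1(G)$, and for $1\le i\le s$ let $\frac{h_i}{g_i}$, with $h_i,g_i\in\mathbb{C}[V]$, $g_i\ne0$,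 without common factors, be an additive relative invariant with associated additive function $\Phi_i$. Let $v_0\in\Omega$, and for $1\le j\le r$ let $v_j\in V(f_j)$ with $v_j\notin V(f_k)$ for all $k\neq j$. Then: 1. Each $f_i$ is invariant under the action of $[G,G]\cdot G_{v_0}$, and of $G_{v_j}$ for every $j\in\{1,\dots,r\}$ with $j\ne i$. 2. Each $h_i$ is invariant under the action of $[G,G]\cdot G_{v_0}$, and of $G_{v_j}$ for every $j\in\{1,\dots,r\}$ with $g_i(v_j)\neq0$. 3. The polynomials $f_1,\dots,f_r,h_1,\dots,h_s$ are algebraically independent over $\mathbb{C}$. -/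

import Mathlib

noncomputable section

namespace Prehomogeneous

/-- The Zariski topology on affine space `κ → ℂ`: the topology induced by the map sending a point
to its maximal ideal in the prime spectrum of the polynomial ring. Its closed sets are exactly
the zero loci of ideals of polynomials, see `isClosed_zariski_iff`. -/
@[reducible] def zariski (κ : Type*) : TopologicalSpace (κ → ℂ) :=
  TopologicalSpace.induced (MvPolynomial.pointToPoint (k := ℂ)) inferInstance

theorem isClosed_zariski_iff {κ : Type*} (S : Set (κ → ℂ)) :
    @IsClosed _ (zariski κ) S ↔
      ∃ P : Set (MvPolynomial κ ℂ), S = {x | ∀ p ∈ P, MvPolynomial.eval x p = 0} := by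
  have key : ∀ P : Set (MvPolynomial κ ℂ),
      (MvPolynomial.pointToPoint (k := ℂ)) ⁻¹' (PrimeSpectrum.zeroLocus P) =
        {x : κ → ℂ | ∀ p ∈ P, MvPolynomial.eval x p = 0} := by
    intro P
    ext x
    simp only [Set.mem_preimage, PrimeSpectrum.mem_zeroLocus, Set.mem_ofPred_eq]
    constructor
    · intro h p hp
      have h1 := h hp
      exact (MvPolynomial.mem_vanishingIdeal_singleton_iff x p).1 h1
    · intro h p hp
      exact (MvPolynomial.mem_vanishingIdeal_singleton_iff x p).2 (h p hp)
  rw [isClosed_induced_iff]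
  constructor
  · rintro ⟨t, ht, rfl⟩
    obtain ⟨P, rfl⟩ := (PrimeSpectrum.isClosed_iff_zeroLocus t).1 ht
    exact ⟨P, key P⟩
  · rintro ⟨P, rfl⟩
    exact ⟨_, PrimeSpectrum.isClosed_zeroLocus P, key P⟩

section Group

variable {m : ℕ}

/-- The coordinates of the affine variety `GL_m(ℂ)`: the matrix entries and the inverse of the
determinant. -/
def glCoord (g : GL (Fin m) ℂ) : Option (Fin m × Fin m) → ℂ
  | none => (g : Matrix (Fin m) (Fin m) ℂ).det⁻¹
  | some (i, j) => (g : Matrix (Fin m) (Fin m) ℂ) i j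

/-- The Zariski topology on `GL_m(ℂ)`. -/
@[reducible] def zariskiGL (m : ℕ) : TopologicalSpace (GL (Fin m) ℂ) :=
  TopologicalSpace.induced glCoord (zariski (Option (Fin m × Fin m)))

/-- A connected complex linear algebraic group: a Zariski closed and Zariski connected subgroup
of some `GL_m(ℂ)`. -/
structure IsConnectedAlgebraicGroup (G : Subgroup (GL (Fin m) ℂ)) : Prop where
  isClosed : @IsClosed _ (zariskiGL m) (G : Set (GL (Fin m) ℂ))
  isConnected : @IsConnected _ (zariskiGL m) (G : Set (GL (Fin m) ℂ))

/-- Regular functions on a linear algebraic group `G ≤ GL_m(ℂ)`: restrictions of polynomials in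
the matrix entries and the inverse of the determinant. -/
def IsRegular (G : Subgroup (GL (Fin m) ℂ)) (F : G → ℂ) : Prop :=
  ∃ p : MvPolynomial (Option (Fin m × Fin m)) ℂ,
    ∀ g : G, F g = MvPolynomial.eval (glCoord (g : GL (Fin m) ℂ)) p

/-- The complex vector space of additive functions of `G`, that is, of homomorphisms of algebraic
groups from `G` to `(ℂ, +)`. -/
def additiveFunctions (G : Subgroup (GL (Fin m) ℂ)) : Submodule ℂ (G → ℂ) where
  carrier := {Φ | IsRegular G Φ ∧ ∀ g h : G, Φ (g * h) = Φ g + Φ h}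
  zero_mem' := ⟨⟨0, fun g => by simp⟩, fun g h => by simp⟩
  add_mem' := by
    rintro Φ Ψ ⟨⟨p, hp⟩, hΦ⟩ ⟨⟨q, hq⟩, hΨ⟩
    refine ⟨⟨p + q, fun g => by simp [hp, hq]⟩, fun g h => ?_⟩
    simp only [Pi.add_apply, hΦ, hΨ]
    ring
  smul_mem' := by
    rintro c Φ ⟨⟨p, hp⟩, hΦ⟩
    refine ⟨⟨MvPolynomial.C c * p, fun g => by simp [hp]⟩, fun g h => ?_⟩
    simp only [Pi.smul_apply, hΦ, smul_add]

end Group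

section Space

variable {m n : ℕ} {V : Type*} [AddCommGroup V] [Module ℂ V]

/-- The value at `v` of a polynomial in the coordinates of `V` given by the basis `b`. -/
def value (b : Module.Basis (Fin n) ℂ V) (p : MvPolynomial (Fin n) ℂ) (v : V) : ℂ :=
  MvPolynomial.eval (b.equivFun v) p

/-- The Zariski topology on `V`. -/
@[reducible] def zariskiV (b : Module.Basis (Fin n) ℂ V) : TopologicalSpace V :=
  TopologicalSpace.induced b.equivFun (zariski (Fin n))

/-- The zero set `V(p)` of a polynomial `p`. -/
def zeroSet (b : Module.Basis (Fin n) ℂ V) (p : MvPolynomial (Fin n) ℂ) : Set V :=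
  {v | value b p v = 0}

/-- The quotient `p / q` in the field of rational functions on `V`. -/
def frac (p q : MvPolynomial (Fin n) ℂ) : FractionRing (MvPolynomial (Fin n) ℂ) :=
  algebraMap _ _ p / algebraMap _ _ q

/-- The rational function `φ` on `V` is defined at `v`, with value `c`. -/
def HasValue (b : Module.Basis (Fin n) ℂ V) (φ : FractionRing (MvPolynomial (Fin n) ℂ))
    (v : V) (c : ℂ) : Prop :=
  ∃ p q : MvPolynomial (Fin n) ℂ,
    value b q v ≠ 0 ∧ φ = frac p q ∧ c = value b p v / value b q v

/-- A representation of `G` on `V` is rational if its matrix coefficients are regular. -/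
def IsRational {G : Subgroup (GL (Fin m) ℂ)} (ρ : Representation ℂ G V) : Prop :=
  ∀ (v : V) (l : Module.Dual ℂ V), IsRegular G (fun g => l (ρ g v))

/-- The isotropy subgroup `G_v`. -/
def isotropy {G : Subgroup (GL (Fin m) ℂ)} (ρ : Representation ℂ G V) (v : V) : Subgroup G where
  carrier := {g | ρ g v = v}
  one_mem' := by simp
  mul_mem' := by
    intro g h hg hh
    simp only [Set.mem_ofPred_eq] at hg hh ⊢
    rw [map_mul, Module.End.mul_apply, hh, hg]
  inv_mem' := by
    intro g hg
    simp only [Set.mem_ofPred_eq] at hg ⊢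
    conv_lhs => rw [← hg]
    rw [← Module.End.mul_apply, ← map_mul, inv_mul_cancel, map_one, Module.End.one_apply]

/-- `(G, ρ, V)` is a prehomogeneous vector space with open orbit `Ω`. -/
structure IsPrehomogeneous (b : Module.Basis (Fin n) ℂ V) (G : Subgroup (GL (Fin m) ℂ))
    (ρ : Representation ℂ G V) (Ω : Set V) : Prop where
  group : IsConnectedAlgebraicGroup G
  rational : IsRational ρ
  isOrbit : ∃ v : V, Ω = Set.range (fun g : G => ρ g v)
  isOpen : @IsOpen _ (zariskiV b) Ω

/-- `Z` is an irreducible component of the subset `S` of `V`. -/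
def IsIrreducibleComponent (b : Module.Basis (Fin n) ℂ V) (S Z : Set V) : Prop :=
  Maximal (fun T : Set V => @IsIrreducible V (zariskiV b) T ∧ T ⊆ S) Z

/-- A hypersurface is the zero set of a nonconstant polynomial. -/
def IsHypersurface (b : Module.Basis (Fin n) ℂ V) (Z : Set V) : Prop :=
  ∃ p : MvPolynomial (Fin n) ℂ, 0 < p.totalDegree ∧ Z = zeroSet b p

/-- `f 1, …, f r` are the basic relative invariants: irreducible polynomials whose zero sets are,
without repetition, the irreducible components of `V \ Ω` that are hypersurfaces. -/
structure IsBasicRelativeInvariants (b : Module.Basis (Fin n) ℂ V) (Ω : Set V) {r : ℕ}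
    (f : Fin r → MvPolynomial (Fin n) ℂ) : Prop where
  irreducible : ∀ i, Irreducible (f i)
  distinct : Function.Injective (fun i => zeroSet b (f i))
  components : ∀ Z : Set V,
    (IsIrreducibleComponent b Ωᶜ Z ∧ IsHypersurface b Z) ↔ ∃ i, zeroSet b (f i) = Z

/-- The rational function `φ` on `V` is an additive relative invariant with associated additive
function `Φ`: it is defined on `Ω`, and `φ (ρ g v) - φ v = Φ g` for all `v ∈ Ω`, `g ∈ G`. -/
def IsAdditiveRelativeInvariant (b : Module.Basis (Fin n) ℂ V) {G : Subgroup (GL (Fin m) ℂ)}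
    (ρ : Representation ℂ G V) (Ω : Set V) (φ : FractionRing (MvPolynomial (Fin n) ℂ))
    (Φ : G → ℂ) : Prop :=
  Φ ∈ additiveFunctions G ∧
    ∀ v ∈ Ω, ∀ g : G, ∃ c d : ℂ, HasValue b φ (ρ g v) c ∧ HasValue b φ v d ∧ c - d = Φ g

theorem HasValue.add {b : Module.Basis (Fin n) ℂ V} {φ ψ : FractionRing (MvPolynomial (Fin n) ℂ)}
    {v : V} {c d : ℂ} (hφ : HasValue b φ v c) (hψ : HasValue b ψ v d) :
    HasValue b (φ + ψ) v (c + d) := by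
  obtain ⟨p, q, hq, rfl, rfl⟩ := hφ
  obtain ⟨p', q', hq', rfl, rfl⟩ := hψ
  have h0 : ∀ q : MvPolynomial (Fin n) ℂ, value b q v ≠ 0 →
      algebraMap _ (FractionRing (MvPolynomial (Fin n) ℂ)) q ≠ 0 := by
    intro q hq h
    apply hq
    rw [(IsFractionRing.to_map_eq_zero_iff).1 h]
    simp [value]
  refine ⟨p * q' + q * p', q * q', ?_, ?_, ?_⟩
  · simpa [value] using ⟨hq, hq'⟩
  · simp only [frac, map_add, map_mul]
    rw [div_add_div _ _ (h0 q hq) (h0 q' hq')]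
  · rw [div_add_div _ _ hq hq']
    simp [value]

theorem HasValue.smul {b : Module.Basis (Fin n) ℂ V} {φ : FractionRing (MvPolynomial (Fin n) ℂ)}
    {v : V} {c : ℂ} (a : ℂ) (hφ : HasValue b φ v c) :
    HasValue b (algebraMap (MvPolynomial (Fin n) ℂ) _ (MvPolynomial.C a) * φ) v (a * c) := by
  obtain ⟨p, q, hq, rfl, rfl⟩ := hφ
  refine ⟨MvPolynomial.C a * p, q, hq, ?_, ?_⟩
  · simp only [frac, map_mul]
    rw [mul_div_assoc]
  · simp [value, mul_div_assoc]

/-- The space `𝒜₁(G)` of the additive functions of `G` that are associated with some additive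
relative invariant. -/
def additiveFunctionsOne (b : Module.Basis (Fin n) ℂ V) {G : Subgroup (GL (Fin m) ℂ)}
    (ρ : Representation ℂ G V) (Ω : Set V) : Submodule ℂ (G → ℂ) where
  carrier := {Φ | ∃ φ, IsAdditiveRelativeInvariant b ρ Ω φ Φ}
  zero_mem' := by
    refine ⟨0, Submodule.zero_mem _, fun v _ g => ?_⟩
    have h : ∀ w : V, HasValue b 0 w 0 := fun w => ⟨0, 1, by simp [value, frac]⟩
    exact ⟨0, 0, h _, h _, by simp⟩
  add_mem' := by
    rintro Φ Ψ ⟨φ, hΦ, hφ⟩ ⟨ψ, hΨ, hψ⟩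
    refine ⟨φ + ψ, Submodule.add_mem _ hΦ hΨ, fun v hv g => ?_⟩
    obtain ⟨c, d, hc, hd, h⟩ := hφ v hv g
    obtain ⟨c', d', hc', hd', h'⟩ := hψ v hv g
    refine ⟨c + c', d + d', hc.add hc', hd.add hd', ?_⟩
    rw [Pi.add_apply, ← h, ← h']
    ring
  smul_mem' := by
    rintro a Φ ⟨φ, hΦ, hφ⟩
    refine ⟨algebraMap (MvPolynomial (Fin n) ℂ) _ (MvPolynomial.C a) * φ,
      Submodule.smul_mem _ a hΦ, fun v hv g => ?_⟩
    obtain ⟨c, d, hc, hd, h⟩ := hφ v hv g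
    refine ⟨a * c, a * d, hc.smul a, hd.smul a, ?_⟩
    rw [Pi.smul_apply, ← h, smul_eq_mul]
    ring

/-- The polynomial `p` is invariant under the action of the subgroup `K` of `G` on `V`. -/
def IsInvariantUnder (b : Module.Basis (Fin n) ℂ V) {G : Subgroup (GL (Fin m) ℂ)}
    (ρ : Representation ℂ G V) (K : Subgroup G) (p : MvPolynomial (Fin n) ℂ) : Prop :=
  ∀ g ∈ K, ∀ v : V, value b p (ρ g v) = value b p v

end Space

end Prehomogeneous

end

/-! Connectedness of `G` makes each `f j` a relative invariant. Its translate by a group element is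
irreducible without zeros on `Ω`, hence a scalar multiple of some `f k`; the elements of `G` sorted
by `k` form finitely many disjoint closed sets, so `k = j` throughout. Let `X j` be the resulting
character. A denominator `g i` has no zeros on `Ω`, so it is a scalar times a monomial in the `f j`
with some exponent vector `N i`. Comparing values on the dense orbit gives `h i (ρ a v) = X^(N i)(a)
* (h i v + Φ i a * g i v)`.

The invariance claims can be read off: characters and additive functions are trivial on commutators,
and if `a` fixes a point where `f i` (or `g i`) is nonzero, the law at that point forces the
character to be `1` (and `Φ i a = 0`).

For independence, pull back along `a ↦ ρ a v₀`. The `f j` become nonzero multiples of the `X j`,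
which are multiplicatively independent by unique factorization, and the `h i` become translates of
the `Φ i` times monomials in the `X j`. It remains to see that such characters and additive
functions are algebraically independent. Polynomials in additive functions are unipotent under
translation, so distinct characters put them into independent joint generalized eigenspaces; and a
polynomial vanishing on a subgroup that spans `ℂ^s` is zero. -/

/-! ### Independence of characters and additive functions on an abstract group. -/

theorem MvPolynomial.eval_bind₁ {σ τ R : Type*} [CommRing R] (x : τ → R)
    (F : σ → MvPolynomial τ R) (p : MvPolynomial σ R) :
    MvPolynomial.eval x (MvPolynomial.bind₁ F p) =
      MvPolynomial.eval (fun i => MvPolynomial.eval x (F i)) p :=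
  MvPolynomial.eval₂Hom_bind₁ (RingHom.id R) x F p

-- The image of `φ` in `ℂ^σ` is an additive subgroup; vanishing on it passes from integer to complex
-- multiples because a one-variable polynomial with infinitely many roots is zero. The statement
-- quantifies over `p` so that the induction can be applied to a translate of `p`.
open Polynomial in
theorem MvPolynomial.eval_add_eq_zero_of_mem_span {A σ : Type*} [Group A]
    {φ : σ → A → ℂ} (hφ : ∀ i a a', φ i (a * a') = φ i a + φ i a') {u : σ → ℂ}
    (hu : u ∈ Submodule.span ℂ (Set.range fun a i => φ i a)) :
    ∀ p : MvPolynomial σ ℂ, (∀ a, MvPolynomial.eval (fun i => φ i a) p = 0) →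
      ∀ a, MvPolynomial.eval (fun i => φ i a + u i) p = 0 := by
  induction hu using Submodule.closure_induction with
  | zero => intro p hp a; simpa using hp a
  | add u v _ _ hu hv =>
    intro p hp a
    let q := MvPolynomial.bind₁ (fun i => MvPolynomial.X i + MvPolynomial.C (u i)) p
    have hq : ∀ x, MvPolynomial.eval x q = MvPolynomial.eval (fun i => x i + u i) p := by
      intro x
      simp [q, MvPolynomial.eval_bind₁]
    have h2 := hv q (fun a => by rw [hq]; exact hu p hp a) a
    rw [hq] at h2
    simpa [add_right_comm, add_assoc, add_comm, add_left_comm] using h2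
  | smul_mem c x hx =>
    obtain ⟨w, rfl⟩ := hx
    intro p hp a
    -- Restriction of `p` to the line through `φ a` with direction `φ w`. It vanishes at each
    -- natural number `k`, the point there being `φ (a * w ^ k)`.
    let q : ℂ[X] := MvPolynomial.aeval
      (fun i => Polynomial.C (φ i a) + Polynomial.X * Polynomial.C (φ i w)) p
    have hq : ∀ t : ℂ, q.eval t = MvPolynomial.eval (fun i => φ i a + t * φ i w) p := by
      intro t
      have := MvPolynomial.comp_aeval_apply (B := ℂ) (Polynomial.aeval t)
        (f := fun i => Polynomial.C (φ i a) + Polynomial.X * Polynomial.C (φ i w)) p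
      simp only [Polynomial.coe_aeval_eq_eval, Polynomial.eval_add, Polynomial.eval_C,
        Polynomial.eval_mul, Polynomial.eval_X] at this
      rw [this, MvPolynomial.aeval_eq_eval]
    have hone : ∀ i, φ i 1 = 0 := fun i => by simpa using hφ i 1 1
    have hpow : ∀ (k : ℕ) i, φ i (w ^ k) = k * φ i w := by
      intro k i
      induction k with
      | zero => simp [hone]
      | succ k ih => rw [pow_succ, hφ, ih]; push_cast; ring
    have hq0 : q = 0 := by
      apply Polynomial.eq_zero_of_infinite_isRoot
      refine (Set.infinite_range_of_injective (Nat.cast_injective (R := ℂ))).mono ?_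
      rintro _ ⟨k, rfl⟩
      simp only [Set.mem_ofPred_eq, Polynomial.IsRoot, hq]
      simpa [hφ, hpow] using hp (a * w ^ k)
    have := hq c
    rw [hq0] at this
    simpa using this.symm

/-- Linearly independent additive functions on a group are algebraically independent. -/
theorem MvPolynomial.eq_zero_of_eval_additive_eq_zero {A σ : Type*} [Group A] [Finite σ]
    {φ : σ → A → ℂ} (hφ : ∀ i a a', φ i (a * a') = φ i a + φ i a')
    (hli : LinearIndependent ℂ φ) {p : MvPolynomial σ ℂ}
    (hp : ∀ a, MvPolynomial.eval (fun i => φ i a) p = 0) : p = 0 := by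
  have hone : ∀ i, φ i 1 = 0 := fun i => by simpa using hφ i 1 1
  have hspan := span_flip_eq_top_iff_linearIndependent.2 hli
  refine MvPolynomial.funext fun u => ?_
  have := MvPolynomial.eval_add_eq_zero_of_mem_span hφ (u := u)
    (by
      have : u ∈ (⊤ : Submodule ℂ (σ → ℂ)) := Submodule.mem_top
      rw [← hspan] at this; exact this) p hp 1
  simpa [hone] using this

/-- The right translation operator on functions on a group. -/
def translation {A : Type*} [Group A] (a : A) : Module.End ℂ (A → ℂ) where
  toFun F x := F (x * a)
  map_add' _ _ := rfl
  map_smul' _ _ := rfl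

@[simp]
theorem translation_apply {A : Type*} [Group A] (a : A) (F : A → ℂ) (x : A) :
    translation a F x = F (x * a) := rfl

/-- Iterated twisted Leibniz rule `(T - 1)(F H) = (T - 1)F · T H + F · (T - 1)H`. The bound `k + l`
is not sharp, but it keeps the base case trivial. -/
theorem translation_sub_one_pow_mul {A : Type*} [Group A] (a : A) (N : ℕ) :
    ∀ (k l : ℕ) (F H : A → ℂ), k + l ≤ N → ((translation a - 1) ^ k) F = 0 →
      ((translation a - 1) ^ l) H = 0 → ((translation a - 1) ^ N) (F * H) = 0 := by
  induction N with
  | zero =>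
    intro k l F H hkl hF _
    obtain rfl : k = 0 := by omega
    have hF : F = 0 := by simpa using hF
    simp [hF]
  | succ N ih =>
    intro k l F H hkl hF hH
    rcases k with _ | k
    · have hF : F = 0 := by simpa using hF
      simp [hF]
    rcases l with _ | l
    · have hH : H = 0 := by simpa using hH
      simp [hH]
    have key : (translation a - 1) (F * H) =
        ((translation a - 1) F) * translation a H + F * ((translation a - 1) H) := by
      ext x
      simp
      ring
    have hcomm : Commute ((translation a - 1) ^ (l + 1)) (translation a) :=
      ((Commute.refl (translation a)).sub_left (Commute.one_left _)).pow_left _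
    have hTH : ((translation a - 1) ^ (l + 1)) (translation a H) = 0 := by
      rw [← Module.End.mul_apply, hcomm.eq, Module.End.mul_apply, hH, map_zero]
    rw [pow_succ, Module.End.mul_apply, key, map_add,
      ih k (l + 1) _ _ (by omega) (by rw [← Module.End.mul_apply, ← pow_succ]; exact hF) hTH,
      ih (k + 1) l _ _ (by omega) hF (by rw [← Module.End.mul_apply, ← pow_succ]; exact hH),
      add_zero]

/-- `T - 1` kills constants and sends an additive function to a constant, so its square kills
additive functions; products follow from the Leibniz rule. -/
theorem exists_translation_sub_one_pow_eval_eq_zero {A σ : Type*} [Group A] {φ : σ → A → ℂ}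
    (hφ : ∀ i a a', φ i (a * a') = φ i a + φ i a') (a : A) (p : MvPolynomial σ ℂ) :
    ∃ k : ℕ, ((translation a - 1) ^ k) (fun x => MvPolynomial.eval (fun i => φ i x) p) = 0 := by
  induction p using MvPolynomial.induction_on with
  | C c =>
    refine ⟨1, ?_⟩
    ext x
    simp
  | add p q hp hq =>
    obtain ⟨k, hk⟩ := hp
    obtain ⟨l, hl⟩ := hq
    refine ⟨k + l, ?_⟩
    have : (fun x => MvPolynomial.eval (fun i => φ i x) (p + q)) =
      (fun x => MvPolynomial.eval (fun i => φ i x) p) +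
        fun x => MvPolynomial.eval (fun i => φ i x) q := by
      ext x
      simp
    rw [this, map_add]
    nth_rewrite 1 [add_comm k l]
    simp [pow_add, Module.End.mul_apply, hk, hl]
  | mul_X p i hp =>
    obtain ⟨k, hk⟩ := hp
    refine ⟨k + 2, ?_⟩
    have : (fun x => MvPolynomial.eval (fun i => φ i x) (p * MvPolynomial.X i)) =
      (fun x => MvPolynomial.eval (fun i => φ i x) p) * φ i := by
      ext x
      simp
    rw [this]
    refine translation_sub_one_pow_mul a _ k 2 _ _ le_rfl hk ?_
    ext x
    simp [pow_two, Module.End.mul_apply, hφ]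

theorem mul_eval_mem_maxGenEigenspace {A σ : Type*} [Group A] {φ : σ → A → ℂ}
    (hφ : ∀ i a a', φ i (a * a') = φ i a + φ i a') (χ : A →* ℂ) (a : A) (p : MvPolynomial σ ℂ) :
    (fun x => χ x * MvPolynomial.eval (fun i => φ i x) p) ∈
      (translation a).maxGenEigenspace (χ a) := by
  obtain ⟨k, hk⟩ := exists_translation_sub_one_pow_eval_eq_zero hφ a p
  rw [Module.End.mem_maxGenEigenspace]
  refine ⟨k, ?_⟩
  -- Multiplication by `χ` intertwines `χ a • (T - 1)` with `T - χ a`.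
  have key : ∀ (k : ℕ) (F : A → ℂ), ((translation a - χ a • 1) ^ k) (χ * F) =
      χ a ^ k • (χ * ((translation a - 1) ^ k) F) := by
    intro k
    induction k with
    | zero => intro F; simp
    | succ k ih =>
      intro F
      have h1 : (translation a - χ a • 1) (χ * F) = χ a • (χ * (translation a - 1) F) := by
        ext x
        simp
        ring
      rw [pow_succ, Module.End.mul_apply, h1, map_smul, ih, smul_smul, ← pow_succ',
        pow_succ (translation a - 1), Module.End.mul_apply]
  have := key k (fun x => MvPolynomial.eval (fun i => φ i x) p)
  rw [hk, mul_zero, smul_zero] at this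
  exact this

/-- Distinct characters of a commutative group are linearly independent over the polynomials in
linearly independent additive functions. -/
theorem eq_zero_of_sum_character_mul_eval_eq_zero {A σ ι : Type*} [CommGroup A] [Finite σ]
    {φ : σ → A → ℂ} (hφ : ∀ i a a', φ i (a * a') = φ i a + φ i a')
    (hli : LinearIndependent ℂ φ) {χ : ι → A →* ℂ} (hχ : Function.Injective χ) (t : Finset ι)
    (p : ι → MvPolynomial σ ℂ)
    (h : ∀ a, ∑ k ∈ t, χ k a * MvPolynomial.eval (fun i => φ i a) (p k) = 0) :
    ∀ k ∈ t, p k = 0 := by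
  -- Commutativity of the group enters here: the translations commute, so joint generalized
  -- eigenspaces for distinct eigenvalue systems are independent.
  have hind := (Module.End.independent_iInf_maxGenEigenspace_of_forall_mapsTo
    (fun a : A => (translation a : Module.End ℂ (A → ℂ))) (fun a a' μ =>
      Module.End.mapsTo_maxGenEigenspace_of_comm (by
        ext F x
        simp [Module.End.mul_apply, mul_assoc, mul_comm a]) μ)).comp
    (f := fun k a => χ k a) (fun k l hkl => hχ (MonoidHom.ext fun a => congrFun hkl a))
  intro k hk
  have hz := (iSupIndep_iff_finsetSum_eq_zero_imp_eq_zero _).1 hind t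
    (fun k x => χ k x * MvPolynomial.eval (fun i => φ i x) (p k)) (fun k _ => by
      simp only [Function.comp, Submodule.mem_iInf]
      exact fun a => mul_eval_mem_maxGenEigenspace hφ (χ k) a (p k))
    (by ext a; simpa using h a) k hk
  refine MvPolynomial.eq_zero_of_eval_additive_eq_zero hφ hli fun a => ?_
  have h0 : χ k a ≠ 0 := fun h0 => by
    have : χ k (a * a⁻¹) = 0 := by rw [map_mul, h0, zero_mul]
    simp at this
  exact (mul_eq_zero.1 (congrFun hz a)).resolve_left h0

theorem MvPolynomial.eval_sumElim_eq_sum {σ τ R : Type*} [CommRing R] [Fintype σ]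
    (x : σ → R) (y : τ → R) (Q : MvPolynomial (σ ⊕ τ) R) :
    MvPolynomial.eval (Sum.elim x y) Q =
      ∑ γ ∈ (MvPolynomial.sumAlgEquiv R σ τ Q).support, (∏ j, x j ^ γ j) *
        MvPolynomial.eval y (MvPolynomial.coeff γ (MvPolynomial.sumAlgEquiv R σ τ Q)) := by
  have h : MvPolynomial.eval (Sum.elim x y) Q =
      MvPolynomial.eval₂ (MvPolynomial.eval y) x (MvPolynomial.sumAlgEquiv R σ τ Q) := by
    induction Q using MvPolynomial.induction_on with
    | C c => simp
    | add p q hp hq => simp [hp, hq]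
    | mul_X p i hp => rcases i with i | i <;> simp [hp]
  rw [h, MvPolynomial.eval₂_eq']
  exact Finset.sum_congr rfl fun γ _ => mul_comm _ _

/-- Multiplicatively independent characters and linearly independent additive functions on a group
are together algebraically independent. -/
theorem MvPolynomial.eq_zero_of_eval_character_additive_eq_zero {A σ τ : Type*} [Group A]
    [Fintype σ] [Finite τ] {X : σ → A →* ℂ}
    (hX : ∀ γ δ : σ →₀ ℕ, (∀ a, ∏ j, X j a ^ γ j = ∏ j, X j a ^ δ j) → γ = δ)
    {φ : τ → A → ℂ} (hφ : ∀ i a a', φ i (a * a') = φ i a + φ i a')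
    (hli : LinearIndependent ℂ φ) {Q : MvPolynomial (σ ⊕ τ) ℂ}
    (hQ : ∀ a, MvPolynomial.eval (Sum.elim (fun j => X j a) (fun i => φ i a)) Q = 0) :
    Q = 0 := by
  -- Characters and additive functions factor through the abelianization, where translations
  -- commute.
  let Y : σ → Abelianization A →* ℂ := fun j =>
    (Units.coeHom ℂ).comp (Abelianization.lift (X j).toHomUnits)
  have hY : ∀ j a, Y j (Abelianization.of a) = X j a := fun j a => by simp [Y]
  let ψ' : τ → Abelianization A →* Multiplicative ℂ := fun i =>
    Abelianization.lift (MonoidHom.mk' (fun a => Multiplicative.ofAdd (φ i a))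
      (fun a a' => by rw [hφ, ofAdd_add]))
  let ψ : τ → Abelianization A → ℂ := fun i a => (ψ' i a).toAdd
  have hψ : ∀ i a, ψ i (Abelianization.of a) = φ i a := fun i a => by simp [ψ, ψ']
  have hψli : LinearIndependent ℂ ψ := by
    refine LinearIndependent.of_comp (LinearMap.funLeft ℂ ℂ (Abelianization.of (G := A))) ?_
    convert hli using 1
    ext i a
    exact hψ i a
  let Z : (σ →₀ ℕ) → Abelianization A →* ℂ := fun γ => ∏ j, Y j ^ γ j
  have hZ : ∀ γ a, Z γ (Abelianization.of a) = ∏ j, X j a ^ γ j := fun γ a => by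
    simp only [Z, MonoidHom.finsetProd_apply, MonoidHom.pow_apply, hY]
  have hZinj : Function.Injective Z := fun γ δ hγδ => hX γ δ fun a => by
    rw [← hZ, ← hZ, hγδ]
  have hψadd : ∀ i a a', ψ i (a * a') = ψ i a + ψ i a' := fun i a a' => by
    simp only [ψ, map_mul, toAdd_mul]
  obtain ⟨P, rfl⟩ := (MvPolynomial.sumAlgEquiv ℂ σ τ).symm.surjective Q
  simp only [MvPolynomial.eval_sumElim_eq_sum, AlgEquiv.apply_symm_apply] at hQ
  have hzero := eq_zero_of_sum_character_mul_eval_eq_zero hψadd hψli hZinj P.support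
    (fun γ => MvPolynomial.coeff γ P) (fun a => by
      obtain ⟨a, rfl⟩ : ∃ a', Abelianization.of a' = a := QuotientGroup.mk_surjective a
      simpa only [hZ, hψ] using hQ a)
  have hP : P = 0 := by
    refine MvPolynomial.ext _ _ fun γ => ?_
    rw [MvPolynomial.coeff_zero]
    by_cases hγ : γ ∈ P.support
    · exact hzero γ hγ
    · exact MvPolynomial.notMem_support_iff.1 hγ
  rw [hP, map_zero]

/-- The algebraic independence of multiplicatively independent characters and linearly independent
additive functions persists after scaling the former, and after translating the latter and
multiplying them by monomials in the former. -/
theorem MvPolynomial.eq_zero_of_eval_twisted_eq_zero {A σ τ : Type*} [Group A]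
    [Fintype σ] [Finite τ] {X : σ → A →* ℂ}
    (hX : ∀ γ δ : σ →₀ ℕ, (∀ a, ∏ j, X j a ^ γ j = ∏ j, X j a ^ δ j) → γ = δ)
    {φ : τ → A → ℂ} (hφ : ∀ i a a', φ i (a * a') = φ i a + φ i a')
    (hli : LinearIndependent ℂ φ) {c : σ → ℂ} (hc : ∀ j, c j ≠ 0) (d e : τ → ℂ)
    (he : ∀ i, e i ≠ 0) (N : τ → σ → ℕ) {Q : MvPolynomial (σ ⊕ τ) ℂ}
    (hQ : ∀ a, MvPolynomial.eval (Sum.elim (fun j => c j * X j a)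
      (fun i => e i * (∏ j, X j a ^ N i j) * (φ i a + d i))) Q = 0) : Q = 0 := by
  let θ : σ ⊕ τ → MvPolynomial (σ ⊕ τ) ℂ := Sum.elim
    (fun j => MvPolynomial.C (c j) * MvPolynomial.X (Sum.inl j))
    (fun i => MvPolynomial.C (e i) * (∏ j, MvPolynomial.X (Sum.inl j) ^ N i j) *
      (MvPolynomial.X (Sum.inr i) + MvPolynomial.C (d i)))
  have heval : ∀ x y, (fun k => MvPolynomial.eval (Sum.elim x y) (θ k)) =
      Sum.elim (fun j => c j * x j) (fun i => e i * (∏ j, x j ^ N i j) * (y i + d i)) := by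
    intro x y
    ext k
    rcases k with j | i <;> simp [θ]
  have hθ : MvPolynomial.bind₁ θ Q = 0 :=
    MvPolynomial.eq_zero_of_eval_character_additive_eq_zero hX hφ hli fun a => by
      rw [MvPolynomial.eval_bind₁, heval]
      exact hQ a
  -- The substitution `θ` is invertible only where the first coordinates are nonzero; the extra
  -- factor covers the remaining points.
  have hprod : Q * ∏ j, MvPolynomial.X (Sum.inl j) = 0 := by
    refine MvPolynomial.funext fun z => ?_
    by_cases hz : ∃ j, z (Sum.inl j) = 0
    · obtain ⟨j, hj⟩ := hz
      simp only [map_mul, map_prod, MvPolynomial.eval_X, map_zero]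
      rw [Finset.prod_eq_zero (Finset.mem_univ j) hj, mul_zero]
    · push Not at hz
      have hx : ∀ i, (∏ j, (z (Sum.inl j) / c j) ^ N i j) ≠ 0 := fun i =>
        Finset.prod_ne_zero_iff.2 fun j _ => pow_ne_zero _ (div_ne_zero (hz j) (hc j))
      have h1 := congrArg (MvPolynomial.eval (Sum.elim (fun j => z (Sum.inl j) / c j)
        (fun i => z (Sum.inr i) / (e i * ∏ j, (z (Sum.inl j) / c j) ^ N i j) - d i))) hθ
      rw [MvPolynomial.eval_bind₁, heval] at h1
      have h2 : Sum.elim (fun j => c j * (z (Sum.inl j) / c j))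
          (fun i => e i * (∏ j, (z (Sum.inl j) / c j) ^ N i j) *
            (z (Sum.inr i) / (e i * ∏ j, (z (Sum.inl j) / c j) ^ N i j) - d i + d i)) = z := by
        ext k
        rcases k with j | i
        · simp [mul_div_cancel₀ _ (hc j)]
        · simp [mul_div_cancel₀ _ (mul_ne_zero (he i) (hx i))]
      rw [h2] at h1
      simp [h1]
  exact (mul_eq_zero.1 hprod).resolve_right
    (Finset.prod_ne_zero_iff.2 fun j _ => MvPolynomial.X_ne_zero _)

/-! ### Zero sets of polynomials and the Zariski topology on `V`. -/

namespace Prehomogeneous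

section Value

variable {n : ℕ} {V : Type*} [AddCommGroup V] [Module ℂ V] (b : Module.Basis (Fin n) ℂ V)

@[simp]
theorem value_mul (p q : MvPolynomial (Fin n) ℂ) (v : V) :
    value b (p * q) v = value b p v * value b q v := map_mul _ _ _

@[simp]
theorem value_C (c : ℂ) (v : V) : value b (MvPolynomial.C c) v = c := MvPolynomial.eval_C _

@[simp]
theorem value_prod_pow {r : ℕ} (f : Fin r → MvPolynomial (Fin n) ℂ) (N : Fin r → ℕ) (v : V) :
    value b (∏ j, f j ^ N j) v = ∏ j, value b (f j) v ^ N j := by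
  simp [value]

theorem value_equivFun_symm (p : MvPolynomial (Fin n) ℂ) (x : Fin n → ℂ) :
    value b p (b.equivFun.symm x) = MvPolynomial.eval x p := by
  rw [value, LinearEquiv.apply_symm_apply]

theorem mem_zeroSet {p : MvPolynomial (Fin n) ℂ} {v : V} :
    v ∈ zeroSet b p ↔ value b p v = 0 := Iff.rfl

theorem eq_of_value_eq {p q : MvPolynomial (Fin n) ℂ} (h : ∀ v, value b p v = value b q v) :
    p = q :=
  MvPolynomial.funext fun x => by
    simpa only [value_equivFun_symm] using h (b.equivFun.symm x)

theorem isClosed_zariskiV_iff (S : Set V) :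
    @IsClosed _ (zariskiV b) S ↔
      ∃ P : Set (MvPolynomial (Fin n) ℂ), S = {v | ∀ p ∈ P, value b p v = 0} := by
  rw [@isClosed_induced_iff V _ (zariski (Fin n))]
  constructor
  · rintro ⟨t, ht, rfl⟩
    obtain ⟨P, rfl⟩ := (isClosed_zariski_iff t).1 ht
    exact ⟨P, rfl⟩
  · rintro ⟨P, rfl⟩
    exact ⟨_, (isClosed_zariski_iff _).2 ⟨P, rfl⟩, rfl⟩

theorem isClosed_zeroSet (p : MvPolynomial (Fin n) ℂ) : @IsClosed _ (zariskiV b) (zeroSet b p) :=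
  (isClosed_zariskiV_iff b _).2 ⟨{p}, by ext v; simp [zeroSet]⟩

/-- Nullstellensatz: the ideal `(p)` is prime, hence the full vanishing ideal of its zero locus. -/
theorem dvd_of_zeroSet_subset {p q : MvPolynomial (Fin n) ℂ} (hp : Irreducible p)
    (h : zeroSet b p ⊆ zeroSet b q) : p ∣ q := by
  have : (Ideal.span {p}).IsPrime := (Ideal.span_singleton_prime hp.ne_zero).2 hp.prime
  rw [← Ideal.mem_span_singleton,
    ← MvPolynomial.IsPrime.vanishingIdeal_zeroLocus (K := ℂ) (Ideal.span {p}),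
    MvPolynomial.mem_vanishingIdeal_iff]
  intro x hx
  have hpx := hx p (Ideal.mem_span_singleton_self p)
  rw [MvPolynomial.aeval_eq_eval] at hpx ⊢
  have := @h (b.equivFun.symm x) (by
    rwa [mem_zeroSet, value_equivFun_symm])
  rwa [mem_zeroSet, value_equivFun_symm] at this

theorem exists_value_ne_zero_of_isOpen {U : Set V} (hU : @IsOpen _ (zariskiV b) U) {v : V}
    (hv : v ∈ U) : ∃ q, value b q v ≠ 0 ∧ Uᶜ ⊆ zeroSet b q := by
  let _ := zariskiV b
  obtain ⟨P, hP⟩ := (isClosed_zariskiV_iff b _).1 hU.isClosed_compl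
  have : v ∉ Uᶜ := fun h => h hv
  rw [hP] at this ⊢
  simp only [Set.mem_ofPred_eq, not_forall] at this
  obtain ⟨q, hq, hqv⟩ := this
  exact ⟨q, hqv, fun w hw => hw q hq⟩

/-- Polynomials that agree on a nonempty open set are equal. -/
theorem eq_of_value_eq_on_isOpen {U : Set V} (hU : @IsOpen _ (zariskiV b) U) (hne : U.Nonempty)
    {p q : MvPolynomial (Fin n) ℂ} (h : ∀ v ∈ U, value b p v = value b q v) : p = q := by
  obtain ⟨v, hv⟩ := hne
  obtain ⟨d, hdv, hd⟩ := exists_value_ne_zero_of_isOpen b hU hv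
  have hd0 : d ≠ 0 := fun h0 => hdv (by simp [h0, value])
  -- After multiplication by `d`, which vanishes off `U`, the two sides agree everywhere.
  refine mul_right_cancel₀ hd0 (eq_of_value_eq b fun w => ?_)
  by_cases hw : w ∈ U
  · simp [h w hw]
  · have : value b d w = 0 := hd hw
    simp [this]

theorem isIrreducible_zeroSet {p : MvPolynomial (Fin n) ℂ} (hp : Irreducible p) :
    @IsIrreducible _ (zariskiV b) (zeroSet b p) := by
  let _ := zariskiV b
  refine ⟨?_, isPreirreducible_iff_isClosed_union_isClosed.2 fun Z₁ Z₂ h₁ h₂ h => ?_⟩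
  · by_contra hne
    rw [Set.not_nonempty_iff_eq_empty] at hne
    exact hp.not_isUnit (isUnit_of_dvd_one (dvd_of_zeroSet_subset b hp (by simp [hne])))
  · obtain ⟨P₁, rfl⟩ := (isClosed_zariskiV_iff b _).1 h₁
    obtain ⟨P₂, rfl⟩ := (isClosed_zariskiV_iff b _).1 h₂
    by_contra! hcon
    obtain ⟨hc₁, hc₂⟩ := hcon
    obtain ⟨v, hv, hv₁⟩ := Set.not_subset.1 hc₁
    obtain ⟨w, hw, hw₂⟩ := Set.not_subset.1 hc₂
    simp only [Set.mem_ofPred_eq, not_forall] at hv₁ hw₂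
    obtain ⟨q₁, hq₁, hqv⟩ := hv₁
    obtain ⟨q₂, hq₂, hqw⟩ := hw₂
    have hdvd : p ∣ q₁ * q₂ := dvd_of_zeroSet_subset b hp fun u hu => by
      rcases h hu with hu | hu
      · simp [zeroSet, hu q₁ hq₁]
      · simp [zeroSet, hu q₂ hq₂]
    rcases hp.prime.dvd_or_dvd hdvd with ⟨e, rfl⟩ | ⟨e, rfl⟩
    · exact hqv (by rw [value_mul, mem_zeroSet b |>.1 hv, zero_mul])
    · exact hqw (by rw [value_mul, mem_zeroSet b |>.1 hw, zero_mul])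

theorem exists_irreducible_of_subset_zeroSet {T : Set V} (hT : @IsIrreducible _ (zariskiV b) T)
    {q : MvPolynomial (Fin n) ℂ} (hq : q ≠ 0) (hTq : T ⊆ zeroSet b q) :
    ∃ p, Irreducible p ∧ T ⊆ zeroSet b p := by
  let _ := zariskiV b
  induction q using WfDvdMonoid.induction_on_irreducible with
  | zero => exact absurd rfl hq
  | unit u hu =>
    obtain ⟨v, hv⟩ := hT.nonempty
    have := hTq hv
    rw [mem_zeroSet] at this
    exact absurd this (hu.map (MvPolynomial.eval (b.equivFun v))).ne_zero
  | mul a p ha hp ih =>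
    have : T ⊆ zeroSet b p ∪ zeroSet b a := fun v hv => by
      have := hTq hv
      rw [mem_zeroSet, value_mul, mul_eq_zero] at this
      exact this
    rcases isPreirreducible_iff_isClosed_union_isClosed.1 hT.isPreirreducible _ _
      (isClosed_zeroSet b p) (isClosed_zeroSet b a) this with h | h
    · exact ⟨p, hp, h⟩
    · exact ih ha h

theorem zeroSet_subset_of_dvd {p q : MvPolynomial (Fin n) ℂ} (h : p ∣ q) :
    zeroSet b p ⊆ zeroSet b q := by
  obtain ⟨e, rfl⟩ := h
  intro v hv
  rw [mem_zeroSet] at hv ⊢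
  rw [value_mul, hv, zero_mul]

/-- Maximality: an irreducible set between `V(p)` and the proper closed set `Uᶜ` lies in some `V(q)`
with `q` irreducible; then `p ∣ q`, so `p` and `q` are associated. -/
theorem isIrreducibleComponent_zeroSet {U : Set V} (hU : @IsOpen _ (zariskiV b) U)
    (hne : U.Nonempty) {p : MvPolynomial (Fin n) ℂ} (hp : Irreducible p)
    (hpU : zeroSet b p ⊆ Uᶜ) : IsIrreducibleComponent b Uᶜ (zeroSet b p) := by
  refine ⟨⟨isIrreducible_zeroSet b hp, hpU⟩, fun T hT hpT => ?_⟩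
  obtain ⟨v, hv⟩ := hne
  obtain ⟨d, hdv, hd⟩ := exists_value_ne_zero_of_isOpen b hU hv
  have hd0 : d ≠ 0 := fun h0 => hdv (by simp [h0, value])
  obtain ⟨q, hq, hTq⟩ := exists_irreducible_of_subset_zeroSet b hT.1 hd0 (hT.2.trans hd)
  have hpq := dvd_of_zeroSet_subset b hp (le_trans hpT hTq)
  exact hTq.trans (zeroSet_subset_of_dvd b ((hp.dvd_symm hq) hpq))

theorem isHypersurface_zeroSet {p : MvPolynomial (Fin n) ℂ} (hp : Irreducible p) :
    IsHypersurface b (zeroSet b p) := by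
  refine ⟨p, Nat.pos_of_ne_zero fun h0 => ?_, rfl⟩
  rw [MvPolynomial.totalDegree_eq_zero_iff_eq_C] at h0
  have hc : MvPolynomial.coeff 0 p ≠ 0 := fun h => hp.ne_zero (by rw [h0, h, map_zero])
  exact hp.not_isUnit (h0 ▸ (IsUnit.mk0 _ hc).map MvPolynomial.C)

/-- The composition of a polynomial with a linear map. -/
noncomputable def precomp (L : V →ₗ[ℂ] V) : MvPolynomial (Fin n) ℂ →ₐ[ℂ] MvPolynomial (Fin n) ℂ :=
  MvPolynomial.bind₁ fun i => ∑ j, MvPolynomial.C (b.repr (L (b j)) i) * MvPolynomial.X j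

@[simp]
theorem value_precomp (L : V →ₗ[ℂ] V) (p : MvPolynomial (Fin n) ℂ) (v : V) :
    value b (precomp b L p) v = value b p (L v) := by
  rw [value, precomp, MvPolynomial.eval_bind₁, value]
  congr 2
  ext i
  have : L v = ∑ j, b.repr v j • L (b j) := by
    conv_lhs => rw [← b.sum_repr v]
    simp only [map_sum, map_smul]
  simp [this, mul_comm]

theorem irreducible_precomp {L M : V →ₗ[ℂ] V} (hLM : ∀ v, L (M v) = v) (hML : ∀ v, M (L v) = v)
    {p : MvPolynomial (Fin n) ℂ} (hp : Irreducible p) : Irreducible (precomp b L p) := by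
  let e : MvPolynomial (Fin n) ℂ ≃ₐ[ℂ] MvPolynomial (Fin n) ℂ :=
    AlgEquiv.ofAlgHom (precomp b L) (precomp b M)
      (AlgHom.ext fun q => eq_of_value_eq b fun v => by simp [hML])
      (AlgHom.ext fun q => eq_of_value_eq b fun v => by simp [hLM])
  exact (MulEquiv.irreducible_iff e).2 hp

end Value

end Prehomogeneous

/-! ### Regular functions and connectedness of the group. -/

namespace Prehomogeneous

section RegularFunctions

variable {m n : ℕ} {V : Type*} [AddCommGroup V] [Module ℂ V] {G : Subgroup (GL (Fin m) ℂ)}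

theorem IsRegular.mul_const {F : G → ℂ} (hF : IsRegular G F) (c : ℂ) :
    IsRegular G fun g => F g * c := by
  obtain ⟨p, hp⟩ := hF
  exact ⟨p * MvPolynomial.C c, fun g => by simp [hp]⟩

theorem IsRegular.sub {F H : G → ℂ} (hF : IsRegular G F) (hH : IsRegular G H) :
    IsRegular G fun g => F g - H g := by
  obtain ⟨p, hp⟩ := hF
  obtain ⟨q, hq⟩ := hH
  exact ⟨p - q, fun g => by simp [hp, hq]⟩

theorem IsRational.isRegular_value {ρ : Representation ℂ G V} (hρ : IsRational ρ)
    (b : Module.Basis (Fin n) ℂ V) (p : MvPolynomial (Fin n) ℂ) (v : V) :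
    IsRegular G fun g => value b p (ρ g v) := by
  choose q hq using fun i => hρ v (b.coord i)
  refine ⟨MvPolynomial.bind₁ q p, fun g => ?_⟩
  rw [MvPolynomial.eval_bind₁]
  simp only [← hq]
  rfl

theorem isClosed_zeros {κ : Type*} (P : κ → MvPolynomial (Option (Fin m × Fin m)) ℂ) :
    @IsClosed _ (zariskiGL m) {x | ∀ i, MvPolynomial.eval (glCoord x) (P i) = 0} := by
  rw [@isClosed_induced_iff (GL (Fin m) ℂ) _ (zariski (Option (Fin m × Fin m)))]
  exact ⟨_, (isClosed_zariski_iff _).2 ⟨Set.range P, rfl⟩, by ext; simp⟩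

/-- If a connected algebraic group is partitioned into finitely many closed subsets, then it is
equal to each of them that contains the identity. -/
theorem IsConnectedAlgebraicGroup.forall_eq_zero_of_partition (hG : IsConnectedAlgebraicGroup G)
    {ι κ : Type*} [Finite ι] (F : ι → κ → G → ℂ) (hF : ∀ i k, IsRegular G (F i k))
    (hcover : ∀ g, ∃ i, ∀ k, F i k g = 0)
    (hdisj : ∀ g i j, (∀ k, F i k g = 0) → (∀ k, F j k g = 0) → i = j)
    (i : ι) (hi : ∀ k, F i k 1 = 0) (g : G) (k : κ) : F i k g = 0 := by
  let _ := zariskiGL m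
  choose P hP using hF
  let S : ι → Set (GL (Fin m) ℂ) := fun i => {x | ∀ k, MvPolynomial.eval (glCoord x) (P i k) = 0}
  have hS : ∀ i, IsClosed (S i) := fun i => isClosed_zeros (P i)
  have hmem : ∀ i (g : G), (g : GL (Fin m) ℂ) ∈ S i ↔ ∀ k, F i k g = 0 := fun i g => by
    simp [S, hP]
  have hcl : IsClosed (⋃ j : {j // j ≠ i}, S j) := isClosed_iUnion_of_finite fun j => hS j
  rcases isPreconnected_iff_subset_of_disjoint_closed.1 hG.isConnected.isPreconnected (S i) _
    (hS i) hcl (fun x hx => by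
      obtain ⟨j, hj⟩ := hcover ⟨x, hx⟩
      by_cases hji : j = i
      · exact Or.inl ((hmem i ⟨x, hx⟩).2 (hji ▸ hj))
      · exact Or.inr (Set.mem_iUnion.2 ⟨⟨j, hji⟩, (hmem j ⟨x, hx⟩).2 hj⟩)) (by
      rw [Set.eq_empty_iff_forall_notMem]
      rintro x ⟨hx, hxi, hxj⟩
      obtain ⟨⟨j, hji⟩, hj⟩ := Set.mem_iUnion.1 hxj
      exact hji (hdisj ⟨x, hx⟩ j i ((hmem j ⟨x, hx⟩).1 hj) ((hmem i ⟨x, hx⟩).1 hxi))) with h | h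
  · exact (hmem i g).1 (h g.2) k
  · obtain ⟨⟨j, hji⟩, hj⟩ := Set.mem_iUnion.1 (h (1 : G).2)
    exact absurd (hdisj 1 j i ((hmem j 1).1 hj) hi) hji

end RegularFunctions

/-! ### Basic relative invariants and their characters. -/

section RelativeInvariants

variable {m n r : ℕ} {V : Type*} [AddCommGroup V] [Module ℂ V] {b : Module.Basis (Fin n) ℂ V}
  {G : Subgroup (GL (Fin m) ℂ)} {ρ : Representation ℂ G V} {Ω : Set V}
  {f : Fin r → MvPolynomial (Fin n) ℂ}

theorem IsPrehomogeneous.nonempty (hPV : IsPrehomogeneous b G ρ Ω) : Ω.Nonempty := by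
  obtain ⟨v, rfl⟩ := hPV.isOrbit
  exact ⟨_, 1, rfl⟩

theorem IsPrehomogeneous.apply_mem (hPV : IsPrehomogeneous b G ρ Ω) {v : V} (hv : v ∈ Ω) (g : G) :
    ρ g v ∈ Ω := by
  obtain ⟨w, rfl⟩ := hPV.isOrbit
  obtain ⟨a, rfl⟩ := hv
  exact ⟨g * a, by simp⟩

theorem IsPrehomogeneous.exists_apply_eq (hPV : IsPrehomogeneous b G ρ Ω) {v w : V} (hv : v ∈ Ω)
    (hw : w ∈ Ω) : ∃ g, ρ g v = w := by
  obtain ⟨u, rfl⟩ := hPV.isOrbit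
  obtain ⟨a, rfl⟩ := hv
  obtain ⟨c, rfl⟩ := hw
  exact ⟨c * a⁻¹, by simp [← Module.End.mul_apply, ← map_mul]⟩

theorem IsBasicRelativeInvariants.value_ne_zero (hf : IsBasicRelativeInvariants b Ω f) (i : Fin r)
    {v : V} (hv : v ∈ Ω) : value b (f i) v ≠ 0 := fun h =>
  ((hf.components _).2 ⟨i, rfl⟩).1.1.2 h hv

theorem IsBasicRelativeInvariants.exists_zeroSet_eq (hf : IsBasicRelativeInvariants b Ω f)
    (hPV : IsPrehomogeneous b G ρ Ω) {p : MvPolynomial (Fin n) ℂ} (hp : Irreducible p)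
    (hpΩ : ∀ v ∈ Ω, value b p v ≠ 0) : ∃ i, zeroSet b (f i) = zeroSet b p :=
  (hf.components _).1 ⟨isIrreducibleComponent_zeroSet b hPV.isOpen hPV.nonempty hp
    fun v hv hvΩ => hpΩ v hvΩ hv, isHypersurface_zeroSet b hp⟩

theorem exists_eq_C_mul_of_zeroSet_eq {p q : MvPolynomial (Fin n) ℂ} (hp : Irreducible p)
    (hq : Irreducible q) (h : zeroSet b q = zeroSet b p) :
    ∃ c : ℂ, c ≠ 0 ∧ p = MvPolynomial.C c * q := by
  obtain ⟨u, hu⟩ := associated_of_dvd_dvd (dvd_of_zeroSet_subset b hq h.le)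
    (dvd_of_zeroSet_subset b hp h.ge)
  obtain ⟨c, hc, hcu⟩ := MvPolynomial.isUnit_iff_eq_C_of_isReduced.1 u.isUnit
  exact ⟨c, hc.ne_zero, by rw [← hu, hcu, mul_comm]⟩

/-- The basic relative invariants are relative invariants. -/
theorem IsBasicRelativeInvariants.exists_character (hf : IsBasicRelativeInvariants b Ω f)
    (hPV : IsPrehomogeneous b G ρ Ω) (i : Fin r) :
    ∃ χ : G →* ℂ, ∀ g v, value b (f i) (ρ g v) = χ g * value b (f i) v := by
  obtain ⟨v₀, hv₀⟩ := hPV.nonempty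
  have hfi : ∀ g : G, value b (f i) (ρ g v₀) ≠ 0 := fun g =>
    hf.value_ne_zero i (hPV.apply_mem hv₀ g)
  have hirr : ∀ g : G, Irreducible (precomp b (ρ g) (f i)) := fun g =>
    irreducible_precomp b (M := ρ g⁻¹) (fun v => by simp [← Module.End.mul_apply, ← map_mul])
      (fun v => by simp [← Module.End.mul_apply, ← map_mul]) (hf.irreducible i)
  -- The 2×2 minors in values at pairs of points vanish exactly when the translate of `f i` by `g`
  -- is proportional to `f k`, which makes this a closed condition on `g`.
  have key := hPV.group.forall_eq_zero_of_partition
    (fun (k : Fin r) (vw : V × V) (g : G) =>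
      value b (f i) (ρ g vw.1) * value b (f k) vw.2 - value b (f i) (ρ g vw.2) * value b (f k) vw.1)
    (fun k vw => ((hPV.rational.isRegular_value b (f i) vw.1).mul_const _).sub
      ((hPV.rational.isRegular_value b (f i) vw.2).mul_const _))
    (fun g => by
      obtain ⟨k, hk⟩ := hf.exists_zeroSet_eq hPV (hirr g) fun v hv => by
        rw [value_precomp]
        exact hf.value_ne_zero i (hPV.apply_mem hv g)
      obtain ⟨c, -, hc⟩ := exists_eq_C_mul_of_zeroSet_eq (hirr g) (hf.irreducible k) hk
      have hval : ∀ v, value b (f i) (ρ g v) = c * value b (f k) v := fun v => by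
        rw [← value_precomp, hc, value_mul, value_C]
      exact ⟨k, fun vw => by simp only [hval]; ring⟩)
    (fun g k l hk hl => by
      -- Pairing with `v₀`, where no factor vanishes, shows that `f k` has the same zeros as the
      -- translate of `f i`; distinctness of the zero sets then determines `k`.
      have hz : ∀ k, (∀ vw : V × V, value b (f i) (ρ g vw.1) * value b (f k) vw.2 -
          value b (f i) (ρ g vw.2) * value b (f k) vw.1 = 0) → ∀ v,
          value b (f k) v = 0 ↔ value b (f i) (ρ g v) = 0 := fun k hk v => by
        have := sub_eq_zero.1 (hk (v, v₀))
        have h2 := hf.value_ne_zero k hv₀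
        constructor
        · intro h0
          simpa [h0, h2] using this
        · intro h0
          simpa [h0, hfi g] using this
      exact hf.distinct (Set.ext fun v => (hz k hk v).trans (hz l hl v).symm))
    i (fun vw => by simp [mul_comm])
  have hsemi : ∀ g v, value b (f i) (ρ g v) =
      value b (f i) (ρ g v₀) / value b (f i) v₀ * value b (f i) v := fun g v => by
    have := sub_eq_zero.1 (key g (v, v₀))
    have h2 := hf.value_ne_zero i hv₀
    field_simp
    exact this
  refine ⟨⟨⟨fun g => value b (f i) (ρ g v₀) / value b (f i) v₀, ?_⟩, fun g h => ?_⟩, hsemi⟩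
  · simpa using div_self (hf.value_ne_zero i hv₀)
  · change value b (f i) (ρ (g * h) v₀) / value b (f i) v₀ = _
    rw [map_mul, Module.End.mul_apply, hsemi, mul_div_assoc]

/-- A polynomial without zeros on the open orbit is a product of basic relative invariants. -/
theorem IsBasicRelativeInvariants.exists_eq_prod (hf : IsBasicRelativeInvariants b Ω f)
    (hPV : IsPrehomogeneous b G ρ Ω) (q : MvPolynomial (Fin n) ℂ)
    (hq : ∀ v ∈ Ω, value b q v ≠ 0) :
    ∃ c : ℂ, c ≠ 0 ∧ ∃ N : Fin r → ℕ, q = MvPolynomial.C c * ∏ j, f j ^ N j := by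
  induction q using WfDvdMonoid.induction_on_irreducible with
  | zero =>
    obtain ⟨v, hv⟩ := hPV.nonempty
    exact absurd (by simp [value]) (hq v hv)
  | unit u hu =>
    obtain ⟨c, hc, rfl⟩ := MvPolynomial.isUnit_iff_eq_C_of_isReduced.1 hu
    exact ⟨c, hc.ne_zero, 0, by simp⟩
  | mul a p ha hp ih =>
    simp only [value_mul, mul_ne_zero_iff] at hq
    obtain ⟨c, hc, N, rfl⟩ := ih fun v hv => (hq v hv).2
    obtain ⟨i, hi⟩ := hf.exists_zeroSet_eq hPV hp fun v hv => (hq v hv).1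
    obtain ⟨d, hd, rfl⟩ := exists_eq_C_mul_of_zeroSet_eq hp (hf.irreducible i) hi
    refine ⟨d * c, mul_ne_zero hd hc, N + Pi.single i 1, ?_⟩
    have : ∏ j, f j ^ (Pi.single i 1 : Fin r → ℕ) j = f i := by
      rw [Finset.prod_eq_single i (fun j _ hj => by simp [hj]) (by simp)]
      simp
    simp only [Pi.add_apply, pow_add, Finset.prod_mul_distrib, this, map_mul]
    ring

theorem le_of_prod_pow_dvd_prod_pow {R ι : Type*} [CommRing R] [IsDomain R] [Fintype ι]
    {f : ι → R} (hp : ∀ i, Prime (f i)) (hf : ∀ i j, f i ∣ f j → i = j) {N M : ι → ℕ}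
    (h : ∏ j, f j ^ N j ∣ ∏ j, f j ^ M j) : N ≤ M := by
  classical
  intro i
  have h1 : f i ^ N i ∣ ∏ j, f j ^ M j := (Finset.dvd_prod_of_mem _ (Finset.mem_univ i)).trans h
  rw [← Finset.prod_erase_mul _ _ (Finset.mem_univ i)] at h1
  have h2 : ¬ f i ∣ ∏ j ∈ Finset.univ.erase i, f j ^ M j := by
    rw [(hp i).dvd_finsetProd_iff]
    rintro ⟨j, hj, hdvd⟩
    exact Finset.ne_of_mem_erase hj (hf i j ((hp i).dvd_of_dvd_pow hdvd)).symm
  exact (pow_dvd_pow_iff (hp i).ne_zero (hp i).not_isUnit).1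
    ((hp i).pow_dvd_of_dvd_mul_left _ h2 h1)

theorem IsBasicRelativeInvariants.eq_of_dvd (hf : IsBasicRelativeInvariants b Ω f) (i j : Fin r)
    (h : f i ∣ f j) : i = j :=
  hf.distinct ((zeroSet_subset_of_dvd b h).antisymm (zeroSet_subset_of_dvd b
    ((hf.irreducible i).dvd_symm (hf.irreducible j) h)))

theorem IsBasicRelativeInvariants.eq_of_C_mul_prod_eq (hf : IsBasicRelativeInvariants b Ω f)
    {c d : ℂ} (hc : c ≠ 0) (hd : d ≠ 0) {N M : Fin r → ℕ}
    (h : MvPolynomial.C c * ∏ j, f j ^ N j = MvPolynomial.C d * ∏ j, f j ^ M j) : N = M := by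
  have hu : ∀ c : ℂ, c ≠ 0 → IsUnit (MvPolynomial.C (σ := Fin n) c) :=
    fun c hc => (IsUnit.mk0 _ hc).map MvPolynomial.C
  have hp := fun i => (hf.irreducible i).prime
  refine le_antisymm (le_of_prod_pow_dvd_prod_pow hp hf.eq_of_dvd ((hu d hd).dvd_mul_left.1 ?_))
    (le_of_prod_pow_dvd_prod_pow hp hf.eq_of_dvd ((hu c hc).dvd_mul_left.1 ?_))
  · rw [← h]; exact dvd_mul_left _ _
  · rw [h]; exact dvd_mul_left _ _

/-- Two monomials in the `f j` with the same character are proportional on the dense orbit, hence as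
polynomials, and unique factorization compares exponents. -/
theorem IsBasicRelativeInvariants.character_independent (hf : IsBasicRelativeInvariants b Ω f)
    (hPV : IsPrehomogeneous b G ρ Ω) {X : Fin r → G →* ℂ}
    (hX : ∀ i g v, value b (f i) (ρ g v) = X i g * value b (f i) v) (γ δ : Fin r →₀ ℕ)
    (h : ∀ g, ∏ j, X j g ^ γ j = ∏ j, X j g ^ δ j) : γ = δ := by
  obtain ⟨v₀, hv₀⟩ := hPV.nonempty
  have hne : ∀ N : Fin r → ℕ, ∏ j, value b (f j) v₀ ^ N j ≠ 0 := fun N =>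
    Finset.prod_ne_zero_iff.2 fun j _ => pow_ne_zero _ (hf.value_ne_zero j hv₀)
  -- The scalars are the values at `v₀` of the opposite monomials, so that both sides agree there.
  refine DFunLike.coe_injective (hf.eq_of_C_mul_prod_eq (hne δ) (hne γ) ?_)
  refine eq_of_value_eq_on_isOpen b hPV.isOpen hPV.nonempty fun v hv => ?_
  obtain ⟨g, rfl⟩ := hPV.exists_apply_eq hv₀ hv
  simp only [value_mul, value_C, value_prod_pow, hX, mul_pow, Finset.prod_mul_distrib, h]
  ring

/-- The reduced denominator divides every other denominator, so a reduced fraction detects the whole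
domain of definition. -/
theorem value_eq_of_hasValue {p q : MvPolynomial (Fin n) ℂ} (hq : q ≠ 0) (hpq : IsRelPrime p q)
    {v : V} {c : ℂ} (h : HasValue b (frac p q) v c) :
    value b q v ≠ 0 ∧ c = value b p v / value b q v := by
  obtain ⟨p', q', hq', hfrac, rfl⟩ := h
  have hq'0 : q' ≠ 0 := fun h0 => hq' (by simp [h0, value])
  have hmul : p * q' = p' * q := by
    rw [frac, frac, div_eq_div_iff (by simpa using hq) (by simpa using hq'0), ← map_mul,
      ← map_mul] at hfrac
    exact IsFractionRing.injective _ _ hfrac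
  obtain ⟨e, rfl⟩ : q ∣ q' := hpq.symm.dvd_of_dvd_mul_left (hmul ▸ dvd_mul_left q p')
  rw [value_mul, mul_ne_zero_iff] at hq'
  refine ⟨hq'.1, ?_⟩
  have := congrArg (fun p => value b p v) hmul
  simp only [value_mul] at this
  rw [value_mul, div_eq_div_iff (mul_ne_zero hq'.1 hq'.2) hq'.1, this]

end RelativeInvariants

end Prehomogeneous

/-! ### Additive relative invariants. -/

namespace Prehomogeneous

open scoped commutatorElement

/-- A commutative monoid as target covers both characters into `ℂ` and, through `Multiplicative ℂ`,
additive functions. -/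
theorem map_commutatorElement_eq_one {A M : Type*} [Group A] [CommMonoid M] (χ : A →* M)
    (a c : A) : χ ⁅a, c⁆ = 1 := by
  rw [commutatorElement_def, map_mul, map_mul, map_mul, mul_right_comm (χ a), ← map_mul χ a,
    mul_inv_cancel, map_one, one_mul, ← map_mul, mul_inv_cancel, map_one]

section AdditiveInvariants

variable {m n r : ℕ} {V : Type*} [AddCommGroup V] [Module ℂ V] {b : Module.Basis (Fin n) ℂ V}
  {G : Subgroup (GL (Fin m) ℂ)} {ρ : Representation ℂ G V} {Ω : Set V}
  {f : Fin r → MvPolynomial (Fin n) ℂ}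

/-- The subgroup of the elements of `G` under which a polynomial is invariant. -/
def invarianceSubgroup (b : Module.Basis (Fin n) ℂ V) (ρ : Representation ℂ G V)
    (p : MvPolynomial (Fin n) ℂ) : Subgroup G where
  carrier := {g | ∀ v, value b p (ρ g v) = value b p v}
  one_mem' v := by simp
  mul_mem' {g h} hg hh v := by rw [map_mul, Module.End.mul_apply, hg, hh]
  inv_mem' {g} hg v := by
    rw [← hg (ρ g⁻¹ v), ← Module.End.mul_apply, ← map_mul, mul_inv_cancel, map_one,
      Module.End.one_apply]

theorem isInvariantUnder_commutator_sup {p : MvPolynomial (Fin n) ℂ} {K : Subgroup G}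
    (hcomm : ∀ a c : G, ∀ v, value b p (ρ ⁅a, c⁆ v) = value b p v)
    (hK : IsInvariantUnder b ρ K p) : IsInvariantUnder b ρ (commutator G ⊔ K) p := by
  have : commutator G ⊔ K ≤ invarianceSubgroup b ρ p :=
    sup_le (Subgroup.commutator_le.2 fun a _ c _ => hcomm a c) hK
  exact this

/-- The transformation law of the numerator and of the denominator of an additive relative
invariant in lowest terms. -/
theorem IsAdditiveRelativeInvariant.transform (hPV : IsPrehomogeneous b G ρ Ω)
    (hf : IsBasicRelativeInvariants b Ω f) {X : Fin r → G →* ℂ}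
    (hX : ∀ i g v, value b (f i) (ρ g v) = X i g * value b (f i) v)
    {p q : MvPolynomial (Fin n) ℂ} (hq : q ≠ 0) (hpq : IsRelPrime p q) {Φ : G → ℂ}
    (h : IsAdditiveRelativeInvariant b ρ Ω (frac p q) Φ) :
    ∃ N : Fin r → ℕ, (∀ v ∈ Ω, value b q v ≠ 0) ∧
      (∀ g v, value b q (ρ g v) = (∏ j, X j g ^ N j) * value b q v) ∧
      ∀ g v, value b p (ρ g v) = (∏ j, X j g ^ N j) * (value b p v + Φ g * value b q v) := by
  have hqΩ : ∀ v ∈ Ω, value b q v ≠ 0 := fun v hv => by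
    obtain ⟨-, d, -, hd, -⟩ := h.2 v hv 1
    exact (value_eq_of_hasValue hq hpq hd).1
  obtain ⟨c, -, N, hN⟩ := hf.exists_eq_prod hPV q hqΩ
  have hqg : ∀ g v, value b q (ρ g v) = (∏ j, X j g ^ N j) * value b q v := fun g v => by
    simp only [hN, value_mul, value_C, value_prod_pow, hX, mul_pow, Finset.prod_mul_distrib]
    ring
  refine ⟨N, hqΩ, hqg, fun g v => ?_⟩
  -- The cocycle relation only concerns points of `Ω`; density of `Ω` turns it into a polynomial
  -- identity, valid also where `q` vanishes.
  have heq : precomp b (ρ g) p =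
      MvPolynomial.C (∏ j, X j g ^ N j) * (p + MvPolynomial.C (Φ g) * q) := by
    refine eq_of_value_eq_on_isOpen b hPV.isOpen hPV.nonempty fun v hv => ?_
    obtain ⟨c', d', hc', hd', hcd⟩ := h.2 v hv g
    obtain ⟨h1, rfl⟩ := value_eq_of_hasValue hq hpq hc'
    obtain ⟨h2, rfl⟩ := value_eq_of_hasValue hq hpq hd'
    have hadd : value b (p + MvPolynomial.C (Φ g) * q) v =
        value b p v + Φ g * value b q v := by simp [value]
    rw [value_precomp, value_mul, value_C, hadd, ← hcd]
    rw [hqg] at h1 ⊢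
    have h3 := left_ne_zero_of_mul h1
    field_simp
    ring
  have := congrArg (fun p => value b p v) heq
  rw [value_precomp, value_mul, value_C] at this
  simpa [value] using this

end AdditiveInvariants

end Prehomogeneous

/-! ### The main theorem. -/

open Prehomogeneous in
open scoped commutatorElement in
theorem mainTheorem8 {m n r s : ℕ} {V : Type*} [AddCommGroup V] [Module ℂ V]
    (b : Module.Basis (Fin n) ℂ V) (G : Subgroup (GL (Fin m) ℂ)) (ρ : Representation ℂ G V)
    (Ω : Set V) (hPV : Prehomogeneous.IsPrehomogeneous b G ρ Ω)
    (f : Fin r → MvPolynomial (Fin n) ℂ)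
    (hf : Prehomogeneous.IsBasicRelativeInvariants b Ω f)
    (Φ : Module.Basis (Fin s) ℂ (Prehomogeneous.additiveFunctionsOne b ρ Ω))
    (h g : Fin s → MvPolynomial (Fin n) ℂ)
    (hg : ∀ i, g i ≠ 0) (hlowest : ∀ i, IsRelPrime (h i) (g i))
    (hΦ : ∀ i, Prehomogeneous.IsAdditiveRelativeInvariant b ρ Ω
      (Prehomogeneous.frac (h i) (g i)) (Φ i : G → ℂ)) :
    (∀ i,
      (∀ v₀ ∈ Ω, Prehomogeneous.IsInvariantUnder b ρ
        (commutator G ⊔ Prehomogeneous.isotropy ρ v₀) (f i)) ∧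
      ∀ j, j ≠ i → ∀ v ∈ Prehomogeneous.zeroSet b (f j),
        (∀ k, k ≠ j → v ∉ Prehomogeneous.zeroSet b (f k)) →
          Prehomogeneous.IsInvariantUnder b ρ (Prehomogeneous.isotropy ρ v) (f i)) ∧
    (∀ i,
      (∀ v₀ ∈ Ω, Prehomogeneous.IsInvariantUnder b ρ
        (commutator G ⊔ Prehomogeneous.isotropy ρ v₀) (h i)) ∧
      ∀ j, ∀ v ∈ Prehomogeneous.zeroSet b (f j),
        (∀ k, k ≠ j → v ∉ Prehomogeneous.zeroSet b (f k)) →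
          Prehomogeneous.value b (g i) v ≠ 0 →
            Prehomogeneous.IsInvariantUnder b ρ (Prehomogeneous.isotropy ρ v) (h i)) ∧
    AlgebraicIndependent ℂ (Sum.elim f h) := by
  choose X hX using hf.exists_character hPV
  choose N hgΩ hgN hhN using fun i => (hΦ i).transform hPV hf hX (hg i) (hlowest i)
  have hadd : ∀ i a c, (Φ i : G → ℂ) (a * c) = (Φ i : G → ℂ) a + (Φ i : G → ℂ) c :=
    fun i => (hΦ i).1.2
  have hXcomm : ∀ j a c, X j ⁅a, c⁆ = 1 := fun j => map_commutatorElement_eq_one (X j)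
  have hΦcomm : ∀ i a c, (Φ i : G → ℂ) ⁅a, c⁆ = 0 := fun i a c => by
    exact map_commutatorElement_eq_one (MonoidHom.mk' (M := G) (G := Multiplicative ℂ)
      (fun a => Multiplicative.ofAdd ((Φ i : G → ℂ) a)) fun a c => by rw [hadd, ofAdd_add]) a c
  have hfix : ∀ i v, value b (f i) v ≠ 0 → IsInvariantUnder b ρ (isotropy ρ v) (f i) := by
    intro i v hv a ha w
    have h1 := hX i a v
    rw [show ρ a v = v from ha] at h1
    rw [hX, (mul_eq_right₀ hv).1 h1.symm, one_mul]
  have hhfix : ∀ i v, value b (g i) v ≠ 0 → IsInvariantUnder b ρ (isotropy ρ v) (h i) := by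
    intro i v hv a ha w
    have h1 := hgN i a v
    have h2 := hhN i a v
    rw [show ρ a v = v from ha] at h1 h2
    -- The law for `g i` at the fixed point `v` makes the character `1`; the law for `h i` then
    -- leaves `Φ i a = 0`.
    rw [(mul_eq_right₀ hv).1 h1.symm, one_mul, left_eq_add, mul_eq_zero_iff_right hv] at h2
    rw [hhN, (mul_eq_right₀ hv).1 h1.symm, h2, zero_mul, add_zero, one_mul]
  refine ⟨fun i => ⟨fun v hv => isInvariantUnder_commutator_sup (fun a c w => ?_)
      (hfix i v (hf.value_ne_zero i hv)), fun j hji v _ hvk => hfix i v (hvk i hji.symm)⟩,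
    fun i => ⟨fun v hv => isInvariantUnder_commutator_sup (fun a c w => ?_)
      (hhfix i v (hgΩ i v hv)), fun j v _ _ hgv => hhfix i v hgv⟩, ?_⟩
  · rw [hX, hXcomm, one_mul]
  · simp [hhN, hXcomm, hΦcomm]
  obtain ⟨v₀, hv₀⟩ := hPV.nonempty
  rw [algebraicIndependent_iff]
  intro Q hQ
  -- Pullback to `G` along the orbit map of `v₀`: the scalings are the values of `f j` and `g i` at
  -- `v₀`, and the translations are those of `h i / g i`.
  refine MvPolynomial.eq_zero_of_eval_twisted_eq_zero (hf.character_independent hPV hX) hadd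
    (Φ.linearIndependent.map' (Submodule.subtype _) (Submodule.ker_subtype _))
    (c := fun j => value b (f j) v₀) (fun j => hf.value_ne_zero j hv₀)
    (fun i => value b (h i) v₀ / value b (g i) v₀) (fun i => value b (g i) v₀)
    (fun i => hgΩ i v₀ hv₀) N fun a => ?_
  have hQa : value b (MvPolynomial.bind₁ (Sum.elim f h) Q) (ρ a v₀) = 0 := by
    rw [show MvPolynomial.bind₁ (Sum.elim f h) Q = 0 from hQ]
    simp [value]
  rw [value, MvPolynomial.eval_bind₁] at hQa
  refine (congrArg (fun z => MvPolynomial.eval z Q) (funext fun k => ?_)).trans hQa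
  rcases k with j | i
  · exact (mul_comm _ _).trans (hX j a v₀).symm
  · have := hgΩ i v₀ hv₀
    refine Eq.trans ?_ (hhN i a v₀).symm
    simp only [Sum.elim_inr]
    field_simp
    ring
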